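/- Let $p$ be an odd prime and let $m,n$ be integers with $2\le n<m$. For a finite-dimensional $\mathbb F_p$-vector space $V$ with a nondegenerate inner product $\langle\cdot,\cdot\rangle$, the Walsh transform of $f:V\to\mathbb F_p$ is $\widehat f(b)=\sum_{x\in V}\epsilon_p^{f(x)-\langle b,x\rangle}$, $\epsilon_p=e^{2\pi i/p}$. The function $f$ is *bent* if $|\widehat f(b)|=p^{\dim V/2}$ for all $b\in V$. A bent function $f$ is *weakly regular* if there are $\zeta\in\{\pm1,\pm i\}$, independent of $b$, and a function $f^*:V\to\mathbb F_p$ with $\widehat f(b)=\zeta\,p^{\dim V/2}\epsilon_p^{f^*(b)}$ for all $b\in V$; otherwise it is *non-weakly regular*. Let $\alpha_0,\alpha_1,\dots,\alpha_n\in\mathbb F_{p^m}$ be linearly independent over $\mathbb F_p$, and let $g:\mathbb F_p^n\to\mathbb F_p$ be a weakly regular bent function. Let $G:\mathbb F_{p^m}\to\mathbb F_{p^m}$ be either - $G(x)=x^{p^k+1}$ for an integer $k\ge 0$ such that $m/\gcd(m,k)$ is odd, or - if $p=3$, $G(x)=x^{(3^k+1)/2}$ for a positive integer $k$ with $\gcd(2m,k)=1$.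 Let $\mathrm{Tr}$ denote the trace from $\mathbb F_{p^m}$ to $\mathbb F_p$. Then the function $F:\mathbb F_{p^m}\times\mathbb F_p^n\to\mathbb F_p$, $$F(x,y_1,\dots,y_n)=\mathrm{Tr}(\alpha_0G(x))+g\bigl(y_1+\mathrm{Tr}(\alpha_1G(x)),\dots,y_n+\mathrm{Tr}(\alpha_nG(x))\bigr),$$ is bent. Moreover, if among the elements $\alpha_0+\sum_{j=1}^n\lambda_j\alpha_j$ with $\lambda_1,\dots,\lambda_n\in\mathbb F_p$ there are both a square and a non-square of $\mathbb F_{p^m}$, then $F$ is non-weakly regular. -/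

import Mathlib

/-- The Walsh transform of `f : V → F_p` with respect to the form `B = ⟨·,·⟩` on `V`:
`b ↦ ∑ x, ε_p ^ (f x - ⟨b, x⟩)`, where `ZMod.stdAddChar a = ε_p ^ a` with `ε_p = exp (2 π i / p)`. -/
noncomputable def walsh {p : ℕ} [Fact p.Prime] {V : Type*} [AddCommGroup V] [Module (ZMod p) V]
    [Fintype V] (B : LinearMap.BilinForm (ZMod p) V) (f : V → ZMod p) (b : V) : ℂ :=
  ∑ x : V, ZMod.stdAddChar (f x - B b x)

/-- `f` is bent: all its Walsh coefficients have absolute value `p ^ (dim V / 2)`. -/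
def IsBent {p : ℕ} [Fact p.Prime] {V : Type*} [AddCommGroup V] [Module (ZMod p) V]
    [Fintype V] (B : LinearMap.BilinForm (ZMod p) V) (f : V → ZMod p) : Prop :=
  ∀ b : V, ‖walsh B f b‖ = (p : ℝ) ^ ((Module.finrank (ZMod p) V : ℝ) / 2)

/-- Weak regularity (of a bent function): there are `ζ ∈ {±1, ±i}`, independent of `b`, and a
function `fd : V → F_p` (the dual) with `f^(b) = ζ p ^ (dim V / 2) ε_p ^ (fd b)` for all `b`. -/
def IsWeaklyRegular {p : ℕ} [Fact p.Prime] {V : Type*} [AddCommGroup V] [Module (ZMod p) V]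
    [Fintype V] (B : LinearMap.BilinForm (ZMod p) V) (f : V → ZMod p) : Prop :=
  ∃ ζ : ℂ, (ζ = 1 ∨ ζ = -1 ∨ ζ = Complex.I ∨ ζ = -Complex.I) ∧
    ∃ fd : V → ZMod p, ∀ b : V,
      walsh B f b =
        ζ * (((p : ℝ) ^ ((Module.finrank (ZMod p) V : ℝ) / 2) : ℝ) : ℂ) * ZMod.stdAddChar (fd b)

/-- The function `F(x, y) = Tr(α₀ G(x)) + g(y₁ + Tr(α₁ G(x)), …, yₙ + Tr(αₙ G(x)))`
on `K × F_p^n`. -/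
noncomputable def semiDirectSum {p : ℕ} [Fact p.Prime] {K : Type*} [Field K] [Algebra (ZMod p) K]
    {n : ℕ} (α : Fin (n + 1) → K) (G : K → K) (g : (Fin n → ZMod p) → ZMod p) :
    K × (Fin n → ZMod p) → ZMod p :=
  fun z => Algebra.trace (ZMod p) K (α 0 * G z.1) +
    g (fun j => z.2 j + Algebra.trace (ZMod p) K (α j.succ * G z.1))

/-! Translating `y` by the vector of traces `Tr(αⱼ G(x))` splits a Walsh coefficient of `F` into one
of `g` times a sum over `K` of `ε_p ^ (Tr(a G(x)) - φ x)`, with `φ` linear and `a = α₀ + ∑ cⱼ αⱼ`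
(`sum_semiDirectSum`). Linear independence gives `a ≠ 0`, and planarity of `G` gives the second
factor absolute value `p ^ (m/2)`; hence bentness.

At `φ = 0` the second factor is a Gauss sum: `G(x) = x ^ (2e)` takes its values as often as `x ^ 2`
does, so a square and a non-square `a` give opposite sums (`sum_pow_nonsquare_eq_neg`). Raising to
the odd power `p` erases every `ε_p ^ *` but keeps this sign, which contradicts weak regularity. -/

/-! ### Character sums of planar functions and of even monomials. -/

section ExponentialSums

variable {K : Type*} [Field K] [Fintype K]

/-- A function is planar if all its difference functions in nonzero directions are injective. -/
def IsPlanar (G : K → K) : Prop :=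
  ∀ u : K, u ≠ 0 → Function.Injective fun x => G (x + u) - G x

theorem AddChar.conj_apply_eq_neg {A : Type*} [AddCommGroup A] [Finite A] (ψ : AddChar A ℂ) (x : A) :
    (starRingEnd ℂ) (ψ x) = ψ (-x) := by
  rw [AddChar.map_neg_eq_inv]
  exact (Complex.inv_eq_conj (ψ.norm_apply x)).symm

/-- Group the terms of `S * conj S` by the difference `u`: for `u ≠ 0`, `G (y + u) - G y` permutes
`K`, so the inner sum vanishes. -/
theorem IsPlanar.norm_sum_sq {G : K → K} (hG : IsPlanar G) {ψ : AddChar K ℂ} (hψ : ψ ≠ 1)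
    (χ : AddChar K ℂ) : ‖∑ x, ψ (G x) * χ x‖ ^ 2 = Fintype.card K := by
  classical
  have key : (∑ x, ψ (G x) * χ x) * (starRingEnd ℂ) (∑ x, ψ (G x) * χ x) = Fintype.card K := by
    have h1 : (∑ x, ψ (G x) * χ x) * (starRingEnd ℂ) (∑ x, ψ (G x) * χ x)
        = ∑ u, χ u * ∑ y, ψ (G (y + u) - G y) := by
      rw [map_sum, Finset.sum_mul_sum, Finset.sum_comm]
      simp_rw [Finset.mul_sum]
      rw [Finset.sum_comm (s := (Finset.univ : Finset K)) (f := fun u y => χ u * _)]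
      refine Finset.sum_congr rfl fun y _ => ?_
      rw [← Equiv.sum_comp (Equiv.addLeft y)]
      refine Finset.sum_congr rfl fun u _ => ?_
      simp only [Equiv.coe_addLeft, map_mul, AddChar.conj_apply_eq_neg, sub_eq_add_neg,
        AddChar.map_add_eq_mul]
      have : χ y * χ (-y) = 1 := by rw [← AddChar.map_add_eq_mul]; simp
      linear_combination ψ (G (y + u)) * χ u * ψ (-G y) * this
    rw [h1, Finset.sum_eq_single 0]
    · simp
    · intro u _ hu
      have hb : Function.Bijective fun x => G (x + u) - G x :=
        Finite.injective_iff_bijective.mp (hG u hu)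
      have := hb.sum_comp (fun z => ψ z)
      rw [this, AddChar.sum_eq_zero_of_ne_one hψ, mul_zero]
    · simp
  rw [Complex.mul_conj, Complex.normSq_eq_norm_sq] at key
  exact_mod_cast key

/-- Each `y` has `1 + quadraticChar K y` square roots, and the constant `1` contributes nothing. -/
theorem sum_comp_sq_mul (hK : ringChar K ≠ 2) [DecidableEq K] {ψ : AddChar K ℂ} (hψ : ψ ≠ 1)
    {a : K} (ha : a ≠ 0) :
    ∑ x, ψ (a * x ^ 2) = quadraticChar K a * ∑ y, (quadraticChar K y : ℂ) * ψ y := by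
  have h1 : ∑ x, ψ (a * x ^ 2) = ∑ y, ((quadraticChar K y : ℂ) + 1) * ψ (a * y) := by
    rw [← Finset.sum_fiberwise (s := Finset.univ) (g := fun x : K => x ^ 2)]
    refine Finset.sum_congr rfl fun y _ => ?_
    have h2 : ∀ x ∈ Finset.univ.filter (fun x : K => x ^ 2 = y), ψ (a * x ^ 2) = ψ (a * y) := by
      intro x hx
      rw [(Finset.mem_filter.mp hx).2]
    rw [Finset.sum_congr rfl h2, Finset.sum_const, nsmul_eq_mul]
    congr 1
    have h3 := quadraticChar_card_sqrts hK y
    have h4 : Finset.univ.filter (fun x : K => x ^ 2 = y) = {x : K | x ^ 2 = y}.toFinset := by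
      ext; simp
    rw [h4]
    exact_mod_cast h3
  have h5 : ∑ y, ψ (a * y) = 0 := by
    rw [(mulLeft_bijective₀ a ha).sum_comp (fun z => ψ z)]
    exact AddChar.sum_eq_zero_of_ne_one hψ
  have h6 : ∑ y, (quadraticChar K y : ℂ) * ψ y
      = ∑ y, (quadraticChar K (a * y) : ℂ) * ψ (a * y) :=
    ((mulLeft_bijective₀ a ha).sum_comp (fun z => (quadraticChar K z : ℂ) * ψ z)).symm
  rw [h1, h6, Finset.mul_sum]
  simp_rw [add_mul, one_mul]
  rw [Finset.sum_add_distrib, h5, add_zero]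
  refine Finset.sum_congr rfl fun y _ => ?_
  have h7 : (quadraticChar K a : ℂ) * quadraticChar K a = 1 := by
    have := quadraticChar_sq_one ha
    rw [sq] at this
    exact_mod_cast this
  rw [map_mul (quadraticChar K)]
  push_cast
  linear_combination -(quadraticChar K y : ℂ) * ψ (a * y) * h7

theorem pow_bijective_of_coprime {e : ℕ} (he0 : e ≠ 0) (he : e.Coprime (Fintype.card K - 1)) :
    Function.Bijective fun x : K => x ^ e := by
  classical
  rw [← Finite.injective_iff_bijective]
  have hu : Function.Injective fun x : Kˣ => x ^ e := by
    have hc : (Nat.card Kˣ).Coprime e := by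
      rwa [Nat.card_eq_fintype_card, Fintype.card_units, Nat.coprime_comm]
    exact (powCoprime hc).injective
  intro x y h
  simp only at h
  by_cases hx : x = 0
  · subst hx
    rw [zero_pow he0] at h
    exact (pow_eq_zero_iff he0 |>.mp h.symm).symm
  · have hy : y ≠ 0 := by
      rintro rfl
      rw [zero_pow he0] at h
      exact hx (pow_eq_zero_iff he0 |>.mp h)
    have := @hu (Units.mk0 x hx) (Units.mk0 y hy) (by ext; simpa using h)
    simpa using congrArg Units.val this

/-- If `gcd (2e, |K| - 1) = 2`, then `x ↦ x ^ (2e)` and `x ↦ x ^ 2` have the same fibre sizes. -/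
theorem sum_comp_pow_two_mul (hodd : Odd (Fintype.card K)) {e : ℕ} (he0 : e ≠ 0)
    (he : e.Coprime ((Fintype.card K - 1) / 2)) (f : K → ℂ) :
    ∑ x : K, f (x ^ (2 * e)) = ∑ x : K, f (x ^ 2) := by
  obtain ⟨h, hh⟩ := hodd
  have hh' : (Fintype.card K - 1) / 2 = h := by omega
  rw [hh'] at he
  obtain ⟨e', he'0, hcop, hpow⟩ : ∃ e', e' ≠ 0 ∧ e'.Coprime (Fintype.card K - 1) ∧
      ∀ x : K, x ^ (2 * e) = (x ^ e') ^ 2 := by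
    have hc : Fintype.card K - 1 = 2 * h := by omega
    rw [hc]
    rcases Nat.even_or_odd e with hev | hod
    · have hhodd : Odd h := by
        by_contra hcon
        rw [Nat.not_odd_iff_even] at hcon
        have := Nat.dvd_gcd hev.two_dvd hcon.two_dvd
        rw [he] at this
        omega
      -- For even `e`, adding the odd `h` restores coprimality to `2 * h`; squaring hides the
      -- change, as `x ^ (2 * h) = 1` for `x ≠ 0`.
      refine ⟨e + h, by omega, Nat.Coprime.mul_right ?_ (by simpa using he), ?_⟩
      · exact (Nat.coprime_two_right).mpr (hev.add_odd hhodd)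
      · intro x
        by_cases hx : x = 0
        · subst hx
          rw [zero_pow (by omega), zero_pow (by omega), zero_pow (by omega)]
        · have := FiniteField.pow_card_sub_one_eq_one x hx
          rw [hc] at this
          rw [← pow_mul, add_mul, pow_add, mul_comm h, this, mul_one, mul_comm]
    · refine ⟨e, he0, Nat.Coprime.mul_right ((Nat.coprime_two_right).mpr hod) he, ?_⟩
      intro x
      rw [← pow_mul, mul_comm]
  simp_rw [hpow]
  exact (pow_bijective_of_coprime he'0 hcop).sum_comp (fun z => f (z ^ 2))

theorem sum_pow_nonsquare_eq_neg (hK : ringChar K ≠ 2) {e : ℕ} (he0 : e ≠ 0)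
    (he : e.Coprime ((Fintype.card K - 1) / 2)) {ψ : AddChar K ℂ} (hψ : ψ ≠ 1)
    {a b : K} (ha0 : a ≠ 0) (ha : IsSquare a) (hb : ¬ IsSquare b) :
    ∑ x, ψ (b * x ^ (2 * e)) = -∑ x, ψ (a * x ^ (2 * e)) := by
  classical
  have hodd : Odd (Fintype.card K) := Nat.odd_iff.mpr (FiniteField.odd_card_of_char_ne_two hK)
  have hb0 : b ≠ 0 := by
    rintro rfl
    exact hb (IsSquare.zero)
  rw [sum_comp_pow_two_mul hodd he0 he (fun z => ψ (b * z)),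
    sum_comp_pow_two_mul hodd he0 he (fun z => ψ (a * z)),
    sum_comp_sq_mul hK hψ ha0, sum_comp_sq_mul hK hψ hb0,
    (quadraticChar_one_iff_isSquare ha0).mpr ha, quadraticChar_neg_one_iff_not_isSquare.mpr hb]
  push_cast
  ring

end ExponentialSums

/-! ### Planarity of the two families and coprimality of their half-exponents. -/

section PlanarMonomials

variable {K : Type*} [Field K] [Fintype K]

theorem Nat.gcd_two_mul_dvd_of_odd_div_gcd {m k : ℕ} (hk : Odd (m / m.gcd k)) :
    (2 * k).gcd m ∣ k := by
  rcases Nat.eq_zero_or_pos (m.gcd k) with h0 | hpos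
  -- Division by zero gives `0`, which is not odd.
  · rw [h0] at hk
    simp at hk
  · have hm : m.gcd k * (m / m.gcd k) = m := Nat.mul_div_cancel' (Nat.gcd_dvd_left m k)
    have hkk : m.gcd k * (k / m.gcd k) = k := Nat.mul_div_cancel' (Nat.gcd_dvd_right m k)
    have hd : (2 * k).gcd m ∣ m.gcd k * (2 * (k / m.gcd k)) := by
      have : m.gcd k * (2 * (k / m.gcd k)) = 2 * k := by
        rw [mul_left_comm, hkk]
      rw [this]
      exact Nat.gcd_dvd_left _ _
    have hd' : (2 * k).gcd m ∣ m.gcd k * (m / m.gcd k) := by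
      rw [hm]
      exact Nat.gcd_dvd_right _ _
    have hcop : (2 * (k / m.gcd k)).gcd (m / m.gcd k) = 1 :=
      Nat.Coprime.mul_left (Nat.coprime_two_left.mpr hk)
        (Nat.coprime_comm.mp (Nat.coprime_div_gcd_div_gcd hpos))
    have := Nat.dvd_gcd hd hd'
    rw [Nat.gcd_mul_left, hcop, mul_one] at this
    exact this.trans (Nat.gcd_dvd_right m k)

/-- A collision in direction `u` gives `w ≠ 0` with `w ^ p ^ k = -w`. Frobenius periods `2k` and `m`
of `w` force period `k`, so `w = -w`. -/
theorem isPlanar_pow_add_one {p m k : ℕ} [Fact p.Prime] [CharP K p] (hp : p ≠ 2)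
    (hcard : Fintype.card K = p ^ m) (hk : Odd (m / m.gcd k)) :
    IsPlanar fun x : K => x ^ (p ^ k + 1) := by
  have h2 : (2 : K) ≠ 0 := Ring.two_ne_zero (by rwa [← CharP.eq K ‹CharP K p› (ringChar.charP K)])
  intro u hu x y hxy
  have hexp : ∀ z : K, (z + u) ^ (p ^ k + 1) - z ^ (p ^ k + 1)
      = z ^ p ^ k * u + z * u ^ p ^ k + u ^ (p ^ k + 1) := by
    intro z
    rw [pow_succ, pow_succ, pow_succ, add_pow_char_pow]
    ring
  simp only [hexp] at hxy
  by_contra hne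
  set w := (x - y) / u with hw
  have hw0 : w ≠ 0 := div_ne_zero (sub_ne_zero.mpr hne) hu
  have hxyw : x - y = w * u := by rw [hw]; field_simp
  have h1 : (x - y) ^ p ^ k * u + (x - y) * u ^ p ^ k = 0 := by
    rw [sub_pow_char_pow]
    linear_combination hxy
  rw [hxyw, mul_pow] at h1
  have h3 : w ^ p ^ k = -w := by
    have : u ^ p ^ k * u * (w ^ p ^ k + w) = 0 := by linear_combination h1
    rcases mul_eq_zero.mp this with h | h
    · exact absurd h (mul_ne_zero (pow_ne_zero _ hu) hu)
    · linear_combination h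
  have hp_odd : Odd p := (Fact.out : p.Prime).odd_of_ne_two hp
  have iter : ∀ (j : ℕ) (z : K), (fun z : K => z ^ p)^[j] z = z ^ p ^ j := by
    intro j z
    rw [pow_iterate]
  have per1 : Function.IsPeriodicPt (fun z : K => z ^ p) (2 * k) w := by
    change (fun z : K => z ^ p)^[2 * k] w = w
    rw [iter, two_mul, pow_add, pow_mul, h3, (hp_odd.pow).neg_pow, h3, neg_neg]
  have per2 : Function.IsPeriodicPt (fun z : K => z ^ p) m w := by
    change (fun z : K => z ^ p)^[m] w = w
    rw [iter, ← hcard, FiniteField.pow_card]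
  have per3 := ((per1.gcd per2).trans_dvd (Nat.gcd_two_mul_dvd_of_odd_div_gcd hk))
  have h4 : w ^ p ^ k = w := by
    rw [← iter]
    exact per3
  have h5 : 2 * w = 0 := by linear_combination h3 - h4
  rcases mul_eq_zero.mp h5 with h | h
  · exact h2 h
  · exact hw0 h

/-- With `r` the gcd, `2 * r` divides `p ^ (2k) - 1` and `p ^ m - 1`, hence `p ^ k - 1`; it also
divides `p ^ k + 1`, hence `2`. -/
theorem coprime_half_pow_add_one {p m k : ℕ} (hp : Odd p) (hk : Odd (m / m.gcd k)) :
    ((p ^ k + 1) / 2).Coprime ((p ^ m - 1) / 2) := by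
  obtain ⟨a, ha⟩ := hp.pow (n := k)
  obtain ⟨b, hb⟩ := hp.pow (n := m)
  have ha' : (p ^ k + 1) / 2 = a + 1 := by omega
  have hb' : (p ^ m - 1) / 2 = b := by omega
  rw [ha', hb', Nat.coprime_iff_gcd_eq_one]
  set r := (a + 1).gcd b with hr
  have h1 : 2 * r ∣ p ^ k + 1 := by
    have : p ^ k + 1 = 2 * (a + 1) := by omega
    rw [this]
    exact Nat.mul_dvd_mul_left 2 (Nat.gcd_dvd_left _ _)
  have h2 : 2 * r ∣ p ^ m - 1 := by
    have : p ^ m - 1 = 2 * b := by omega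
    rw [this]
    exact Nat.mul_dvd_mul_left 2 (Nat.gcd_dvd_right _ _)
  have h3 : 2 * r ∣ p ^ (2 * k) - 1 := by
    have : p ^ (2 * k) - 1 = (p ^ k + 1) * (p ^ k - 1) := by
      rw [mul_comm 2 k, pow_mul]
      exact Nat.sq_sub_sq (p ^ k) 1
    rw [this]
    exact h1.mul_right _
  have h4 := Nat.dvd_gcd h3 h2
  rw [Nat.pow_sub_one_gcd_pow_sub_one] at h4
  have h5 : 2 * r ∣ p ^ k - 1 :=
    h4.trans (Nat.pow_sub_one_dvd_pow_sub_one p (Nat.gcd_two_mul_dvd_of_odd_div_gcd hk))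
  have h6 : 2 * r ∣ 2 * 1 := by
    have := Nat.dvd_sub h1 h5
    have h : p ^ k + 1 - (p ^ k - 1) = 2 * 1 := by omega
    rwa [h] at this
  exact Nat.dvd_one.mp (Nat.dvd_of_mul_dvd_mul_left two_pos h6)

theorem three_pow_mod_eight_of_odd {k : ℕ} (hk : Odd k) : 3 ^ k % 8 = 3 := by
  obtain ⟨j, rfl⟩ := hk
  rw [pow_succ, pow_mul, Nat.mul_mod, Nat.pow_mod]
  simp

/-- The gcd divides `3 ^ 2 - 1 = 8`, but `(3 ^ k + 1) / 4` is odd because `3 ^ k ≡ 3` mod 8. -/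
theorem coprime_quarter_three_pow_add_one {k m : ℕ} (hk : (2 * m).gcd k = 1) :
    ((3 ^ k + 1) / 4).Coprime ((3 ^ m - 1) / 2) := by
  have hmod := three_pow_mod_eight_of_odd
    (Nat.coprime_two_left.mp (Nat.Coprime.coprime_dvd_left (Dvd.intro m rfl) hk))
  set e := (3 ^ k + 1) / 4 with he
  have h4e : 3 ^ k + 1 = 4 * e := by omega
  have hodd : Odd e := Nat.odd_iff.mpr (by omega)
  obtain ⟨b, hb⟩ : Odd (3 ^ m) := Odd.pow (by decide)
  have hb' : (3 ^ m - 1) / 2 = b := by omega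
  rw [hb', Nat.coprime_iff_gcd_eq_one]
  set r := e.gcd b with hr
  have h1 : r ∣ 3 ^ (2 * k) - 1 := by
    have : 3 ^ (2 * k) - 1 = (3 ^ k + 1) * (3 ^ k - 1) := by
      rw [mul_comm 2 k, pow_mul]
      exact Nat.sq_sub_sq (3 ^ k) 1
    rw [this, h4e]
    exact ((Nat.gcd_dvd_left e b).mul_left 4).mul_right _
  have h2 : r ∣ 3 ^ m - 1 := by
    have : 3 ^ m - 1 = 2 * b := by omega
    rw [this]
    exact (Nat.gcd_dvd_right e b).mul_left 2
  have h3 := Nat.dvd_gcd h1 h2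
  rw [Nat.pow_sub_one_gcd_pow_sub_one] at h3
  have hkm : k.Coprime m := (Nat.Coprime.coprime_dvd_left (Dvd.intro_left 2 rfl) hk).symm
  have h4 : (2 * k).gcd m ∣ 2 := by
    rw [hkm.gcd_mul_right_cancel]
    exact Nat.gcd_dvd_left 2 m
  have h5 : r ∣ 2 ^ 3 := h3.trans (Nat.pow_sub_one_dvd_pow_sub_one 3 h4)
  have h6 : r.Coprime (2 ^ 3) :=
    ((Nat.coprime_two_right.mpr hodd).pow_right 3).coprime_dvd_left (Nat.gcd_dvd_left e b)
  exact h6.eq_one_of_dvd h5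

theorem coprime_half_three_pow_sub_one {k m : ℕ} (hk : (2 * m).gcd k = 1) :
    ((3 ^ k - 1) / 2).Coprime (3 ^ (2 * m) - 1) := by
  have hmod := three_pow_mod_eight_of_odd
    (Nat.coprime_two_left.mp (Nat.Coprime.coprime_dvd_left (Dvd.intro m rfl) hk))
  have hpos : 0 < 3 ^ k := by positivity
  set e := (3 ^ k - 1) / 2 with he
  have hodd : Odd e := Nat.odd_iff.mpr (by omega)
  have h1 : 3 ^ k - 1 = 2 * e := by omega
  have h2 := Nat.pow_sub_one_gcd_pow_sub_one 3 k (2 * m)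
  rw [Nat.gcd_comm k, hk, pow_one] at h2
  have h3 : e.gcd (3 ^ (2 * m) - 1) ∣ 2 := by
    have := Nat.gcd_dvd_gcd_mul_left_left e (3 ^ (2 * m) - 1) 2
    rwa [← h1, h2] at this
  exact (Nat.coprime_two_right.mpr hodd).coprime_dvd_left (Nat.gcd_dvd_left e _) |>.eq_one_of_dvd h3

/-- Injectivity of Dickson polynomials of the first kind on a finite field of order `q`. -/
theorem dickson_injective {L : Type*} [Field L] {q e : ℕ} (he : e.Coprime (q ^ 2 - 1))
    (hadd : ∀ x y : L, (x + y) ^ q = x ^ q + y ^ q) (hq : 0 < q)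
    {v w : L} (hv0 : v ≠ 0) (hw0 : w ≠ 0)
    (hv : (v + v⁻¹) ^ q = v + v⁻¹) (hw : (w + w⁻¹) ^ q = w + w⁻¹)
    (h : v ^ e + (v ^ e)⁻¹ = w ^ e + (w ^ e)⁻¹) : v + v⁻¹ = w + w⁻¹ := by
  have symm_eq : ∀ a b : L, a ≠ 0 → b ≠ 0 → a + a⁻¹ = b + b⁻¹ → a = b ∨ a = b⁻¹ := by
    intro a b ha hb hab
    have : (a - b) * (a * b - 1) = 0 := by
      field_simp at hab
      linear_combination hab
    rcases mul_eq_zero.mp this with h | h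
    · exact Or.inl (sub_eq_zero.mp h)
    · exact Or.inr (eq_inv_of_mul_eq_one_left (sub_eq_zero.mp h))
  -- Here `a ^ q` is `a` or `a⁻¹`, so `a ^ q ^ 2 = a`; on such elements the `e`-th power is
  -- injective.
  have order : ∀ a : L, a ≠ 0 → (a + a⁻¹) ^ q = a + a⁻¹ → a ^ (q ^ 2 - 1) = 1 := by
    intro a ha haq
    rw [hadd, inv_pow] at haq
    have h2 : a ^ q ^ 2 = a := by
      rcases symm_eq _ _ (pow_ne_zero q ha) ha haq with h | h
      · rw [sq, pow_mul, h, h]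
      · rw [sq, pow_mul, h, inv_pow, h, inv_inv]
    have h3 : a ^ (q ^ 2 - 1) * a = 1 * a := by
      rw [← pow_succ, Nat.sub_add_cancel (Nat.one_le_pow _ _ hq), h2, one_mul]
    exact mul_right_cancel₀ ha h3
  have ov := order v hv0 hv
  have ow := order w hw0 hw
  have pow_inj : ∀ a b : L, b ≠ 0 → a ^ (q ^ 2 - 1) = 1 → b ^ (q ^ 2 - 1) = 1 → a ^ e = b ^ e →
      a = b := by
    intro a b hb ha1 hb1 hab
    have h1 : (a / b) ^ e = 1 := by rw [div_pow, hab, div_self (pow_ne_zero _ hb)]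
    have h2 : (a / b) ^ (q ^ 2 - 1) = 1 := by rw [div_pow, ha1, hb1, div_one]
    have h3 : (a / b) ^ (e.gcd (q ^ 2 - 1)) = 1 := pow_gcd_eq_one.mpr ⟨h1, h2⟩
    rw [he, pow_one] at h3
    exact (div_eq_one_iff_eq hb).mp h3
  rcases symm_eq _ _ (pow_ne_zero e hv0) (pow_ne_zero e hw0) h with h | h
  · rw [pow_inj v w hw0 ov ow h]
  · rw [pow_inj v w⁻¹ (inv_ne_zero hw0) ov (by rw [inv_pow, ow, inv_one]) (by rw [h, inv_pow]),
      inv_inv, add_comm]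

/-- Since `-1 = 2`, both bases are squares over `w`, and `2 * (e + 1) = 3 ^ k + 1` lets Frobenius
expand the powers. -/
theorem coulterMatthews_sub_eq_dickson {L : Type*} [Field L] [CharP L 3] {k e : ℕ}
    (he : 3 ^ k = e + (e + 1)) {w : L} (hw : w ≠ 0) :
    (w + w⁻¹ - 1) ^ (e + 1) - (w + w⁻¹ + 1) ^ (e + 1) = -(w ^ e + (w ^ e)⁻¹) := by
  have : Fact (Nat.Prime 3) := ⟨Nat.prime_three⟩
  have h3 : (3 : L) = 0 := by exact_mod_cast CharP.cast_eq_zero L 3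
  have e1 : w + w⁻¹ - 1 = (w + 1) ^ 2 / w := by
    field_simp
    linear_combination -w * h3
  have e2 : w + w⁻¹ + 1 = (w - 1) ^ 2 / w := by
    field_simp
    linear_combination w * h3
  have e3 : (w + 1) ^ (2 * (e + 1)) = (w ^ (e + (e + 1)) + 1) * (w + 1) := by
    have : 2 * (e + 1) = 3 ^ k + 1 := by omega
    rw [this, pow_succ, add_pow_char_pow, one_pow, he]
  have e4 : (w - 1) ^ (2 * (e + 1)) = (w ^ (e + (e + 1)) - 1) * (w - 1) := by
    have : 2 * (e + 1) = 3 ^ k + 1 := by omega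
    rw [this, pow_succ, sub_pow_char_pow, one_pow, he]
  rw [e1, e2, div_pow, div_pow, ← pow_mul, ← pow_mul, e3, e4]
  have hwe : w ^ e ≠ 0 := pow_ne_zero _ hw
  rw [pow_add, pow_succ]
  field_simp
  linear_combination (w ^ e * w ^ e + 1) * w * h3

/-- The Coulter–Matthews monomials are planar. -/
theorem isPlanar_coulterMatthews {m k : ℕ} [CharP K 3] (hcard : Fintype.card K = 3 ^ m)
    (hk : (2 * m).gcd k = 1) : IsPlanar fun x : K => x ^ ((3 ^ k + 1) / 2) := by
  set L := AlgebraicClosure K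
  have : Fact (Nat.Prime 3) := ⟨Nat.prime_three⟩
  have : CharP L 3 := charP_of_injective_algebraMap (algebraMap K L).injective 3
  have h3 : (3 : L) = 0 := by exact_mod_cast CharP.cast_eq_zero L 3
  set e := (3 ^ k - 1) / 2 with he
  have hodd : Odd (3 ^ k) := Odd.pow (by decide)
  have hd : (3 ^ k + 1) / 2 = e + 1 := by
    obtain ⟨r, hr⟩ := hodd
    omega
  have h3k : 3 ^ k = e + (e + 1) := by
    obtain ⟨r, hr⟩ := hodd
    omega
  have hcop : e.Coprime ((3 ^ m) ^ 2 - 1) := by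
    rw [← pow_mul, mul_comm m 2]
    exact coprime_half_three_pow_sub_one hk
  have lift : ∀ z : K, ∃ w : L, w ≠ 0 ∧ algebraMap K L z = w + w⁻¹ := by
    intro z
    -- In characteristic 3, `z ^ 2 - 1` is the discriminant of `w ^ 2 - z * w + 1`, and `1 / 2 =
    -- -1`.
    obtain ⟨s, hs⟩ := IsAlgClosed.exists_pow_nat_eq ((algebraMap K L z) ^ 2 - 1) (n := 2) (by norm_num)
    have hprod : (s - algebraMap K L z) * (-s - algebraMap K L z) = 1 := by
      linear_combination -hs
    refine ⟨s - algebraMap K L z, left_ne_zero_of_mul_eq_one hprod, ?_⟩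
    rw [inv_eq_of_mul_eq_one_right hprod]
    linear_combination (algebraMap K L z) * h3
  have hq : ∀ z : K, (algebraMap K L z) ^ 3 ^ m = algebraMap K L z := by
    intro z
    rw [← map_pow, ← hcard, FiniteField.pow_card]
  have base : ∀ z z' : K, (z - 1) ^ (e + 1) - (z + 1) ^ (e + 1)
      = (z' - 1) ^ (e + 1) - (z' + 1) ^ (e + 1) → z = z' := by
    intro z z' hzz
    obtain ⟨w, hw0, hw⟩ := lift z
    obtain ⟨v, hv0, hv⟩ := lift z'
    have := congrArg (algebraMap K L) hzz
    simp only [map_sub, map_pow, map_add, map_one, hw, hv] at this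
    rw [coulterMatthews_sub_eq_dickson h3k hw0, coulterMatthews_sub_eq_dickson h3k hv0, neg_inj] at this
    have res := dickson_injective hcop (fun x y => add_pow_char_pow x y 3 m) (by positivity) hw0 hv0
      (by rw [← hw]; exact hq z) (by rw [← hv]; exact hq z') this
    rw [← hw, ← hv] at res
    exact (algebraMap K L).injective res
  have h3K : (3 : K) = 0 := by exact_mod_cast CharP.cast_eq_zero K 3
  intro u hu x y hxy
  simp only [hd] at hxy
  -- Scaling to direction 1 and centring, with `-2 = 1`, gives the symmetric difference in `base`.
  have conv : ∀ x : K, (x + u) ^ (e + 1) - x ^ (e + 1)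
      = u ^ (e + 1) * ((x / u - 1 - 1) ^ (e + 1) - (x / u - 1 + 1) ^ (e + 1)) := by
    intro x
    rw [mul_sub, ← mul_pow, ← mul_pow]
    congr 2
    · field_simp
      linear_combination u * h3K
    · field_simp
      ring
  rw [conv, conv] at hxy
  have := base _ _ (mul_left_cancel₀ (pow_ne_zero _ hu) hxy)
  rw [sub_left_inj] at this
  exact (div_left_inj' hu).mp this

end PlanarMonomials

/-! ### Factorisation of the Walsh transform and its consequences. -/

section WalshTransform

variable {p : ℕ} [Fact p.Prime]

theorem exists_bilinForm_apply_eq {V : Type*} [AddCommGroup V] [Module (ZMod p) V] [Finite V]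
    {B : LinearMap.BilinForm (ZMod p) V} (hB : B.Nondegenerate) (φ : V →ₗ[ZMod p] ZMod p) :
    ∃ b, B b = φ :=
  ⟨(B.toDual hB).symm φ, LinearMap.ext fun v => LinearMap.BilinForm.apply_toDual_symm_apply (hB := hB) φ v⟩

theorem stdAddChar_pow_char (a : ZMod p) : (ZMod.stdAddChar a : ℂ) ^ p = 1 := by
  rw [← AddChar.map_nsmul_eq_pow]
  simp

/-- The additive character `x ↦ ε_p ^ Tr(a x)`. -/
noncomputable def traceAddChar (p : ℕ) [Fact p.Prime] {K : Type*} [Field K] [Algebra (ZMod p) K]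
    (a : K) : AddChar K ℂ :=
  ZMod.stdAddChar.compAddMonoidHom
    ((Algebra.trace (ZMod p) K).toAddMonoidHom.comp (AddMonoidHom.mulLeft a))

theorem traceAddChar_apply {K : Type*} [Field K] [Algebra (ZMod p) K] (a x : K) :
    traceAddChar p a x = ZMod.stdAddChar (Algebra.trace (ZMod p) K (a * x)) := rfl

variable {K : Type*} [Field K] [Fintype K] [Algebra (ZMod p) K]

theorem traceAddChar_ne_one {a : K} (ha : a ≠ 0) : traceAddChar p a ≠ 1 := by
  intro h
  have hnd := (traceForm_nondegenerate (ZMod p) K).1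
  refine ha (hnd a fun y => ?_)
  have h1 : (ZMod.stdAddChar (Algebra.trace (ZMod p) K (a * y)) : ℂ) = 1 := by
    rw [← traceAddChar_apply, h, AddChar.one_apply]
  rw [← AddChar.map_zero_eq_one (ZMod.stdAddChar (N := p))] at h1
  exact ZMod.injective_stdAddChar h1

theorem IsPlanar.norm_walsh_trace {G : K → K} (hG : IsPlanar G) {a : K} (ha : a ≠ 0)
    (φ : K →ₗ[ZMod p] ZMod p) :
    ‖∑ x, (ZMod.stdAddChar (Algebra.trace (ZMod p) K (a * G x) - φ x) : ℂ)‖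
      = (p : ℝ) ^ ((Module.finrank (ZMod p) K : ℝ) / 2) := by
  have h := hG.norm_sum_sq (traceAddChar_ne_one (p := p) ha)
    (ZMod.stdAddChar.compAddMonoidHom (-φ).toAddMonoidHom)
  have h1 : ∀ x, (ZMod.stdAddChar (Algebra.trace (ZMod p) K (a * G x) - φ x) : ℂ)
      = traceAddChar p a (G x) * ZMod.stdAddChar.compAddMonoidHom (-φ).toAddMonoidHom x := by
    intro x
    rw [sub_eq_add_neg, AddChar.map_add_eq_mul]
    rfl
  simp_rw [h1]
  rw [Module.card_eq_pow_finrank (K := ZMod p), ZMod.card] at h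
  rw [← Real.sqrt_sq (norm_nonneg _), h, Real.sqrt_eq_rpow]
  push_cast
  rw [← Real.rpow_natCast, ← Real.rpow_mul (Nat.cast_nonneg p)]
  congr 1
  ring

/-- The Walsh transform of a semi-direct sum factors. -/
theorem sum_semiDirectSum {n : ℕ} (α : Fin (n + 1) → K) (G : K → K)
    (g : (Fin n → ZMod p) → ZMod p) (φ : K →ₗ[ZMod p] ZMod p) (c : Fin n → ZMod p) :
    ∑ z : K × (Fin n → ZMod p),
        (ZMod.stdAddChar (semiDirectSum α G g z - (φ z.1 + ∑ j, c j * z.2 j)) : ℂ)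
      = (∑ y, (ZMod.stdAddChar (g y - ∑ j, c j * y j) : ℂ)) *
        ∑ x, ZMod.stdAddChar
          (Algebra.trace (ZMod p) K ((α 0 + ∑ j, c j • α j.succ) * G x) - φ x) := by
  rw [Fintype.sum_prod_type, Finset.mul_sum]
  refine Finset.sum_congr rfl fun x _ => ?_
  rw [Finset.sum_mul, ← Equiv.sum_comp
    (Equiv.addRight fun j : Fin n => Algebra.trace (ZMod p) K (α j.succ * G x))
    (fun y => (ZMod.stdAddChar (g y - ∑ j, c j * y j) : ℂ) * _)]
  refine Finset.sum_congr rfl fun y _ => ?_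
  rw [← AddChar.map_add_eq_mul]
  congr 1
  have h1 : Algebra.trace (ZMod p) K ((α 0 + ∑ j, c j • α j.succ) * G x)
      = Algebra.trace (ZMod p) K (α 0 * G x)
        + ∑ j, c j * Algebra.trace (ZMod p) K (α j.succ * G x) := by
    rw [add_mul, map_add, Finset.sum_mul, map_sum]
    simp_rw [smul_mul_assoc, map_smul, smul_eq_mul]
  have h2 : (y + fun j : Fin n => Algebra.trace (ZMod p) K (α j.succ * G x))
      = fun j => y j + Algebra.trace (ZMod p) K (α j.succ * G x) := rfl
  simp only [semiDirectSum, Equiv.coe_addRight, h1, h2, mul_add, Finset.sum_add_distrib]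
  ring

theorem add_sum_smul_ne_zero {F M : Type*} [Field F] [AddCommGroup M] [Module F M] {n : ℕ}
    {α : Fin (n + 1) → M} (hα : LinearIndependent F α) (c : Fin n → F) :
    α 0 + ∑ j, c j • α j.succ ≠ 0 := by
  intro h
  rw [Fintype.linearIndependent_iff] at hα
  have := hα (Fin.cons 1 c) (by simpa [Fin.sum_univ_succ] using h) 0
  simp at this

theorem linearMap_prod_pi_apply {F M : Type*} [Field F] [AddCommGroup M] [Module F M] {n : ℕ}
    (φ : M × (Fin n → F) →ₗ[F] F) (z : M × (Fin n → F)) :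
    φ z = (φ ∘ₗ LinearMap.inl F M (Fin n → F)) z.1 + ∑ j, φ (0, Pi.single j 1) * z.2 j := by
  classical
  obtain ⟨x, y⟩ := z
  have h1 : (x, y) = (x, 0) + ((0 : M), y) := by simp
  have h2 := LinearMap.pi_apply_eq_sum_univ (φ ∘ₗ LinearMap.inr F M (Fin n → F)) y
  rw [h1, map_add, ← h1]
  congr 1
  refine h2.trans (Finset.sum_congr rfl fun j _ => ?_)
  rw [smul_eq_mul, mul_comm]
  congr 2
  rw [LinearMap.comp_apply, LinearMap.inr_apply]
  congr 2
  ext i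
  simp [Pi.single_apply, eq_comm]

/-- `B` need not respect the product or be related to `B₀`: only the functional `B b` enters, and
nondegeneracy of `B₀` represents its restriction to `F_p^n`. -/
theorem walsh_semiDirectSum {n : ℕ} {B₀ : LinearMap.BilinForm (ZMod p) (Fin n → ZMod p)}
    (hB₀ : B₀.Nondegenerate) (B : LinearMap.BilinForm (ZMod p) (K × (Fin n → ZMod p)))
    (α : Fin (n + 1) → K) (G : K → K) (g : (Fin n → ZMod p) → ZMod p)
    (b : K × (Fin n → ZMod p)) :
    ∃ b₀, walsh B (semiDirectSum α G g) b = walsh B₀ g b₀ *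
      ∑ x, ZMod.stdAddChar (Algebra.trace (ZMod p) K
        ((α 0 + ∑ j, B b (0, Pi.single j 1) • α j.succ) * G x) - B b (x, 0)) := by
  obtain ⟨b₀, hb₀⟩ := exists_bilinForm_apply_eq hB₀
    (∑ j, B b (0, Pi.single j 1) • LinearMap.proj (R := ZMod p) (φ := fun _ : Fin n => ZMod p) j)
  refine ⟨b₀, ?_⟩
  have h := sum_semiDirectSum α G g (B b ∘ₗ LinearMap.inl (ZMod p) K (Fin n → ZMod p))
    (fun j => B b (0, Pi.single j 1))
  simp_rw [← linearMap_prod_pi_apply (B b)] at h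
  unfold walsh
  rw [h, hb₀]
  simp

theorem isBent_semiDirectSum {n : ℕ} {B₀ : LinearMap.BilinForm (ZMod p) (Fin n → ZMod p)}
    (hB₀ : B₀.Nondegenerate) (B : LinearMap.BilinForm (ZMod p) (K × (Fin n → ZMod p)))
    {α : Fin (n + 1) → K} (hα : LinearIndependent (ZMod p) α) {G : K → K} (hG : IsPlanar G)
    {g : (Fin n → ZMod p) → ZMod p} (hg : IsBent B₀ g) :
    IsBent B (semiDirectSum α G g) := by
  intro b
  obtain ⟨b₀, h⟩ := walsh_semiDirectSum hB₀ B α G g b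
  have h1 := hG.norm_walsh_trace (p := p)
    (add_sum_smul_ne_zero hα fun j => B b (0, Pi.single j 1))
    (B b ∘ₗ LinearMap.inl (ZMod p) K (Fin n → ZMod p))
  simp only [LinearMap.comp_apply, LinearMap.inl_apply] at h1
  rw [h, norm_mul, hg b₀, h1, ← Real.rpow_add (by exact_mod_cast (Fact.out : p.Prime).pos),
    Module.finrank_prod]
  congr 1
  push_cast
  ring

theorem not_isWeaklyRegular_semiDirectSum {n : ℕ}
    {B₀ : LinearMap.BilinForm (ZMod p) (Fin n → ZMod p)} (hB₀ : B₀.Nondegenerate)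
    {B : LinearMap.BilinForm (ZMod p) (K × (Fin n → ZMod p))} (hB : B.Nondegenerate)
    (hp : Odd p) {α : Fin (n + 1) → K} {G : K → K} {g : (Fin n → ZMod p) → ZMod p}
    (hg : IsWeaklyRegular B₀ g) {c d : Fin n → ZMod p}
    (hcd : ∑ x, (ZMod.stdAddChar
          (Algebra.trace (ZMod p) K ((α 0 + ∑ j, d j • α j.succ) * G x)) : ℂ)
      = -∑ x, ZMod.stdAddChar
          (Algebra.trace (ZMod p) K ((α 0 + ∑ j, c j • α j.succ) * G x))) :
    ¬ IsWeaklyRegular B (semiDirectSum α G g) := by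
  rintro ⟨ζ, hζ, fd, hfd⟩
  obtain ⟨ξ, -, gd, hgd⟩ := hg
  have hp0 : (0 : ℝ) < p := by exact_mod_cast (Fact.out : p.Prime).pos
  set P : ℂ := (((p : ℝ) ^ ((Module.finrank (ZMod p) (Fin n → ZMod p) : ℝ) / 2) : ℝ) : ℂ)
  set Q : ℂ := (((p : ℝ) ^ ((Module.finrank (ZMod p) (K × (Fin n → ZMod p)) : ℝ) / 2) : ℝ) : ℂ)
    with hQ
  have hQ0 : ζ * Q ≠ 0 := by
    refine mul_ne_zero ?_ (Complex.ofReal_ne_zero.mpr (Real.rpow_pos_of_pos hp0 _).ne')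
    rcases hζ with rfl | rfl | rfl | rfl <;> simp
  -- The `p`-th power removes both dual values, so the left side is independent of `c`. The `b` used
  -- makes `B b` vanish on `K` with coordinates `c` on `F_p^n`.
  have key : ∀ c : Fin n → ZMod p, (ζ * Q) ^ p = (ξ * P * ∑ x, ZMod.stdAddChar
      (Algebra.trace (ZMod p) K ((α 0 + ∑ j, c j • α j.succ) * G x))) ^ p := by
    intro c
    obtain ⟨b, hb⟩ := exists_bilinForm_apply_eq hB
      ((∑ j, c j • LinearMap.proj (R := ZMod p) (φ := fun _ : Fin n => ZMod p) j) ∘ₗ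
        LinearMap.snd (ZMod p) K (Fin n → ZMod p))
    obtain ⟨b₀, h⟩ := walsh_semiDirectSum hB₀ B α G g b
    rw [hfd b, hgd b₀, hb] at h
    simp only [LinearMap.comp_apply, LinearMap.snd_apply, map_zero, sub_zero,
      LinearMap.sum_apply, LinearMap.smul_apply, LinearMap.proj_apply, Pi.single_apply,
      smul_eq_mul, mul_ite, mul_one, mul_zero, Finset.sum_ite_eq',
      Finset.mem_univ, if_true] at h
    have h2 := congrArg (· ^ p) h
    simp only [mul_pow, stdAddChar_pow_char, mul_one] at h2 ⊢
    exact h2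
  have h1 := key c
  have h2 := key d
  rw [hcd, mul_neg, hp.neg_pow, ← h1] at h2
  exact pow_ne_zero p hQ0 (self_eq_neg.mp h2)

end WalshTransform

/-! ### Both families treated uniformly, and the conclusion. -/

theorem isPlanar_and_eq_pow_two_mul {p m : ℕ} [Fact p.Prime] (hp : p ≠ 2) {K : Type*} [Field K]
    [Fintype K] [CharP K p] (hcard : Fintype.card K = p ^ m) {G : K → K}
    (hG : (∃ k : ℕ, Odd (m / Nat.gcd m k) ∧ G = fun x => x ^ (p ^ k + 1)) ∨
      (p = 3 ∧ ∃ k : ℕ, Nat.gcd (2 * m) k = 1 ∧ G = fun x => x ^ ((3 ^ k + 1) / 2))) :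
    IsPlanar G ∧ ∃ e : ℕ, e ≠ 0 ∧ e.Coprime ((Fintype.card K - 1) / 2) ∧
      G = fun x => x ^ (2 * e) := by
  rw [hcard]
  have hodd : Odd p := (Fact.out : p.Prime).odd_of_ne_two hp
  rcases hG with ⟨k, hk, rfl⟩ | ⟨rfl, k, hk, rfl⟩
  · obtain ⟨r, hr⟩ := hodd.pow (n := k)
    refine ⟨isPlanar_pow_add_one hp hcard hk, (p ^ k + 1) / 2, by omega,
      coprime_half_pow_add_one hodd hk, ?_⟩
    rw [Nat.mul_div_cancel' (by omega)]
  · have hmod := three_pow_mod_eight_of_odd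
      (Nat.coprime_two_left.mp (Nat.Coprime.coprime_dvd_left (Dvd.intro m rfl) hk))
    refine ⟨isPlanar_coulterMatthews hcard hk, (3 ^ k + 1) / 4, by omega,
      coprime_quarter_three_pow_add_one hk, ?_⟩
    have : (3 ^ k + 1) / 2 = 2 * ((3 ^ k + 1) / 4) := by omega
    rw [this]

theorem corollary1 (p : ℕ) [Fact p.Prime] (hp : p ≠ 2)
    (m n : ℕ) (hn : 2 ≤ n) (hnm : n < m)
    (K : Type*) [Field K] [Fintype K] [Algebra (ZMod p) K]
    (hK : Module.finrank (ZMod p) K = m)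
    -- arbitrary nondegenerate inner products on `F_p^n` and on `K × F_p^n`
    (B₀ : LinearMap.BilinForm (ZMod p) (Fin n → ZMod p)) (hB₀ : B₀.Nondegenerate)
    (B : LinearMap.BilinForm (ZMod p) (K × (Fin n → ZMod p))) (hB : B.Nondegenerate)
    (α : Fin (n + 1) → K) (hα : LinearIndependent (ZMod p) α)
    (g : (Fin n → ZMod p) → ZMod p) (hg : IsBent B₀ g) (hgw : IsWeaklyRegular B₀ g)
    (G : K → K)
    (hG : (∃ k : ℕ, Odd (m / Nat.gcd m k) ∧ G = fun x => x ^ (p ^ k + 1)) ∨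
      (p = 3 ∧ ∃ k : ℕ, Nat.gcd (2 * m) k = 1 ∧ G = fun x => x ^ ((3 ^ k + 1) / 2))) :
    IsBent B (semiDirectSum α G g) ∧
      ((∃ c : Fin n → ZMod p, IsSquare (α 0 + ∑ j, c j • α j.succ)) →
        (∃ c : Fin n → ZMod p, ¬ IsSquare (α 0 + ∑ j, c j • α j.succ)) →
        ¬ IsWeaklyRegular B (semiDirectSum α G g)) := by
  have : CharP K p := charP_of_injective_algebraMap (algebraMap (ZMod p) K).injective p
  have hcard : Fintype.card K = p ^ m := by
    rw [Module.card_eq_pow_finrank (K := ZMod p), ZMod.card, hK]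
  obtain ⟨hplanar, e, he0, he, hGe⟩ := isPlanar_and_eq_pow_two_mul hp hcard hG
  refine ⟨isBent_semiDirectSum hB₀ B hα hplanar hg, ?_⟩
  rintro ⟨c, hc⟩ ⟨d, hd⟩
  refine not_isWeaklyRegular_semiDirectSum hB₀ hB ((Fact.out : p.Prime).odd_of_ne_two hp) hgw
    (c := c) (d := d) ?_
  have hchar : ringChar K ≠ 2 := by rwa [ringChar.eq K p]
  have h := sum_pow_nonsquare_eq_neg hchar he0 he (traceAddChar_ne_one (p := p) one_ne_zero)
    (add_sum_smul_ne_zero hα c) hc hd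
  simpa only [traceAddChar_apply, one_mul, hGe] using h
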